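/- Setting. Let $\kappa\ge 1$, let $A_1,\dots,A_\kappa$ be invertible linear maps of $\mathbb R^2$ that are contractions for the Euclidean norm, let $c_1,\dots,c_\kappa\in\mathbb R^2$, and put $\varphi_i(x)=A_ix+c_i$. Let $E\subset\mathbb R^2$ be the associated self-affine set, that is, the unique non-empty compact set with $E=\bigcup_{i=1}^{\kappa}\varphi_i(E)$. For a finite word $\mathtt i=(i_1,\dots,i_n)$ over $\{1,\dots,\kappa\}$ write $|\mathtt i|=n$, $A_{\mathtt i}=A_{i_1}\cdots A_{i_n}$ and $\varphi_{\mathtt i}=\varphi_{i_1}\circ\cdots\circ\varphi_{i_n}$. Let $\alpha_1(\mathtt i)\ge\alpha_2(\mathtt i)$ be the singular values of $A_{\mathtt i}$, and, when $\alpha_1(\mathtt i)>\alpha_2(\mathtt i)$, let $\vartheta_1(\mathtt i)$ be the line through the origin containing the longer semiaxis of the ellipse $A_{\mathtt i}(B(0,1))$. * The system is a *carpet* if every $A_i$ is a diagonal matrix. * The system is *dominated* if there are $\tau>1$ and $n_0\in\mathbb N$ with $\alpha_1(\mathtt i)>\tau^{|\mathtt i|}\alpha_2(\mathtt i)$ for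 all finite words $\mathtt i$ with $|\mathtt i|\ge n_0$. For a dominated system, let $\Theta$ be the set of all lines $\lim_{n\to\infty}\vartheta_1(\mathtt j|_n)$, where $\mathtt j\in\{1,\dots,\kappa\}^{\mathbb N}$, $\mathtt j|_n$ is the word of its first $n$ letters, and the distance of two lines through the origin is the angle between them. * For $e\in S^1$ let $\mathrm{proj}^e$ be the orthogonal projection of $\mathbb R^2$ onto the line $e^\perp$. A dominated system satisfies the *projection condition* if some line through the origin is not in $\Theta$, and if for every $e\in S^1$ whose span is not in $\Theta$ there is $n_0$ such that $\mathrm{proj}^e\varphi_{\mathtt i}(E)$ is a non-degenerate interval for all finite words $\mathtt i$ with $|\mathtt i|\ge n_0$. * The *visible part* of $E$ in direction $e\in S^1$ is $\mathrm{vis}^e(E)=\{x\in\mathbb R^2:\ \{x+te:t\ge 0\}\cap E=\{x\}\}$. * $\dim_H$ is the Hausdorff dimension. $\dim_A F$ is the Assouad dimension: the infimum of all $s\ge 0$ for which there is a constant $C$ such that, for all $x\in F$ and $0<r<R$, the set $F\cap B(x,R)$ can be covered by at most $C(R/r)^s$ balls of radius $r$. **Corollary.** Suppose that the system is a dominated carpet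 and satisfies the projection condition. Then there is $e_0\in S^1$ such that $$\dim_H \mathrm{vis}^e(E)=\dim_A \mathrm{vis}^e(E)=1\qquad\text{for every } e\in S^1\setminus\{e_0,-e_0\}.$$ -/

import Mathlib

open Set Filter Topology
open scoped NNReal ENNReal Pointwise

noncomputable section

/-- The Euclidean plane. -/
abbrev Plane : Type := EuclideanSpace ℝ (Fin 2)

/-! ### Visible parts, projections and the Assouad dimension -/

/-- The closed half line `{t e : t ≥ 0}`. -/
def halfLine (e : Plane) : Set Plane := {y | ∃ t : ℝ, 0 ≤ t ∧ y = t • e}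

/-- The visible part of `E` in direction `e`: all `x` with `({x} + halfLine e) ∩ E = {x}`. -/
def visiblePart (E : Set Plane) (e : Plane) : Set Plane :=
  {x | (({x} : Set Plane) + halfLine e) ∩ E = {x}}

/-- The orthogonal projection along the direction `e`, i.e. onto the orthogonal complement
of the line spanned by `e`. -/
def projAlong (e : Plane) : Plane →L[ℝ] Plane := (ℝ ∙ e)ᗮ.starProjection

/-- A set in the plane is a non-trivial (compact) interval: a line segment with distinct
endpoints. -/
def IsNontrivialInterval (S : Set Plane) : Prop := ∃ a b : Plane, a ≠ b ∧ S = segment ℝ a b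

/-- `s` is an admissible exponent for the Assouad dimension of `F`: for some constant `C`, all
`0 < r < R` and all `x ∈ F`, the set `F ∩ B(x, R)` is covered by at most `C (R / r) ^ s` balls of
radius `r`. -/
def IsAssouadExponent {X : Type*} [PseudoMetricSpace X] (F : Set X) (s : ℝ≥0) : Prop :=
  ∃ C : ℝ, ∀ x ∈ F, ∀ r R : ℝ, 0 < r → r < R →
    ∃ t : Finset X, (t.card : ℝ) ≤ C * (R / r) ^ (s : ℝ) ∧
      F ∩ Metric.closedBall x R ⊆ ⋃ y ∈ t, Metric.closedBall y r

/-- The Assouad dimension of a set: the infimum of the admissible exponents. -/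
def assouadDim {X : Type*} [PseudoMetricSpace X] (F : Set X) : ℝ≥0∞ :=
  ⨅ (s : ℝ≥0) (_ : IsAssouadExponent F s), (s : ℝ≥0∞)

/-! ### Orientations of linear maps of the plane -/

/-- `α₁(T)`, the length of the longer semiaxis of `T (B(0,1))`: the square root of the larger
eigenvalue of `Tᵀ T`. -/
def alpha₁ (T : Plane →ₗ[ℝ] Plane) : ℝ := T.singularValues 0

/-- `α₂(T)`, the length of the shorter semiaxis of `T (B(0,1))`: the square root of the smaller
eigenvalue of `Tᵀ T`. -/
def alpha₂ (T : Plane →ₗ[ℝ] Plane) : ℝ := T.singularValues 1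

/-- `ϑ₁(T)`, the orientation of the longer semiaxis of `T (B(0,1))`: the image under `T` of the
eigenspace of `Tᵀ T` for the eigenvalue `α₁(T) ^ 2`. It is a line when `α₁(T) > α₂(T) > 0`. -/
def orientation₁ (T : Plane →ₗ[ℝ] Plane) : Submodule ℝ Plane :=
  (Module.End.eigenspace (LinearMap.adjoint T ∘ₗ T) (alpha₁ T ^ 2)).map T

/-- The angle (in `[0, π / 2]`) between two lines through the origin: the least angle between a
nonzero vector of the one and a nonzero vector of the other. -/
def lineAngle (L M : Submodule ℝ Plane) : ℝ :=
  sInf {t | ∃ x ∈ L, ∃ y ∈ M, x ≠ 0 ∧ y ≠ 0 ∧ t = InnerProductGeometry.angle x y}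

/-! ### Affine iterated function systems -/

/-- A finite system of contractive invertible affine maps `x ↦ A i x + c i` of the plane. -/
structure AffineIFS (κ : ℕ) where
  /-- the matrices of the linear parts -/
  A : Fin κ → Matrix (Fin 2) (Fin 2) ℝ
  /-- the translation vectors -/
  c : Fin κ → Plane
  invertible : ∀ i, IsUnit (A i)
  contractive : ∀ i, ∃ K : ℝ≥0, ContractingWith K (Matrix.toEuclideanLin (A i))

namespace AffineIFS

variable {κ : ℕ} (Φ : AffineIFS κ)

/-- The affine map `φ i x = A i x + c i`. -/
def map (i : Fin κ) (x : Plane) : Plane := Matrix.toEuclideanLin (Φ.A i) x + Φ.c i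

/-- `φ_w = φ_{w₁} ∘ ⋯ ∘ φ_{wₙ}` for a finite word `w`. -/
def wordMap : List (Fin κ) → Plane → Plane
  | [] => id
  | i :: w => Φ.map i ∘ wordMap w

/-- The linear map `A_w = A_{w₁} ⋯ A_{wₙ}` for a finite word `w`. -/
def wordLin (w : List (Fin κ)) : Plane →ₗ[ℝ] Plane :=
  Matrix.toEuclideanLin (w.map Φ.A).prod

/-- `E` is the self-affine set of the system: the non-empty compact set `E` with
`E = ⋃ i, φ i (E)`. -/
def IsSelfAffineSet (E : Set Plane) : Prop :=
  E.Nonempty ∧ IsCompact E ∧ E = ⋃ i, Φ.map i '' E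

/-- The system is a carpet if all the linear parts are diagonal matrices. -/
def IsCarpet : Prop := ∀ i, (Φ.A i).IsDiag

/-- Dominated splitting. -/
def IsDominated : Prop :=
  ∃ τ : ℝ, 1 < τ ∧ ∃ n₀ : ℕ, ∀ w : List (Fin κ), n₀ ≤ w.length →
    τ ^ w.length * alpha₂ (Φ.wordLin w) < alpha₁ (Φ.wordLin w)

/-- The set of limit orientations: the lines `L` through the origin for which there is an infinite
word `j` with `ϑ₁(j|ₙ) → L` as `n → ∞`, where `j|ₙ` consists of the first `n` letters of `j`. -/
def limitOrientations : Set (Submodule ℝ Plane) :=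
  {L | Module.finrank ℝ L = 1 ∧ ∃ j : ℕ → Fin κ,
    Tendsto (fun n : ℕ =>
      lineAngle (orientation₁ (Φ.wordLin (List.ofFn fun k : Fin n => j k))) L) atTop (𝓝 0)}

/-- The projection condition: some line through the origin is not a limit orientation, and for
each unit vector `e` that does not span a limit orientation, the projection along `e` of every
cylinder of a sufficiently high level is a non-trivial interval. -/
def ProjectionCondition (E : Set Plane) : Prop :=
  (∃ L : Submodule ℝ Plane, Module.finrank ℝ L = 1 ∧ L ∉ Φ.limitOrientations) ∧
  ∀ e : Plane, ‖e‖ = 1 → (ℝ ∙ e) ∉ Φ.limitOrientations →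
    ∃ n₀ : ℕ, ∀ w : List (Fin κ), n₀ ≤ w.length →
      IsNontrivialInterval (projAlong e '' (Φ.wordMap w '' E))

end AffineIFS

end

/-! ### Coverings and dimensions -/

/-! In a dominated carpet a single coordinate `d` is the longer one for all long words
(`IsDominated.exists_dominant_coordinate`), so every long cylinder has its major axis along the
`d`-axis. No other line is a limit orientation (`span_notMem_limitOrientations`), so `e₀` is the
unit vector of that axis, and for every other `e` the projection condition makes long cylinders
project to intervals.

Lower bound: on each line parallel to `e` that meets `E` the furthest point is visible. The visible
part therefore projects onto a nondegenerate segment, and projections are Lipschitz.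

Upper bound: the Assouad dimension dominates the Hausdorff dimension of a bounded set, so it
suffices to bound the former. Let `u` be a coordinate across `e` and `v` a height along `e`.
Domination makes small cylinders flat: their height is at most `δ` while their shadow is an interval
much longer than `δ` (`exists_cylinders`). If the shadow is longer than `4R`, the cylinder of a
visible point `p` in a ball of radius `R` casts its shadow past one side of the ball. Every visible
`q` on that side of `p` sees the cylinder on its own line, hence cannot lie more than `δ` below `p`.
Thus the visible part in the ball splits into two graphs that are monotone up to `δ`, and such
graphs need only `O(R/δ)` balls of radius `O(δ)` (`exists_cover_visiblePart`). Iterating over scales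
gives every exponent above one. -/

theorem dimH_le_of_isAssouadExponent {X : Type*} [MetricSpace X] {F : Set X} {s : ℝ≥0}
    (hF : Bornology.IsBounded F) (hs : IsAssouadExponent F s) : dimH F ≤ s := by
  obtain rfl | ⟨x, hx⟩ := F.eq_empty_or_nonempty
  · simp
  obtain ⟨C, hC⟩ := hs
  obtain ⟨R₀, hR₀⟩ := hF.subset_closedBall x
  obtain ⟨R, hR, hRpos⟩ : ∃ R, R₀ ≤ R ∧ 0 < R := ⟨max R₀ 1, le_max_left _ _, by positivity⟩
  have hFR : F ⊆ Metric.closedBall x R := hR₀.trans (Metric.closedBall_subset_closedBall hR)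
  borelize X
  apply dimH_le_of_hausdorffMeasure_ne_top
  -- The shift by two keeps `r n < R` strict even at `n = 0`, as the covering hypothesis demands.
  let r : ℕ → ℝ := fun n => R / (n + 2)
  have hr0 : ∀ n, 0 < r n := fun n => by positivity
  have hrR : ∀ n, r n < R := fun n => by
    apply div_lt_self hRpos
    have : (0 : ℝ) ≤ n := n.cast_nonneg
    linarith
  choose t ht htF using fun n => hC x hx (r n) R (hr0 n) (hrR n)
  have hrlim : Tendsto (fun n => ENNReal.ofReal (2 * r n)) atTop (𝓝 0) := by
    rw [← ENNReal.ofReal_zero]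
    apply ENNReal.tendsto_ofReal
    have : Tendsto (fun n : ℕ => R / ((n : ℝ) + 2)) atTop (𝓝 0) :=
      tendsto_const_nhds.div_atTop
        (tendsto_atTop_add_const_right _ _ tendsto_natCast_atTop_atTop)
    simpa using this.const_mul 2
  have hdiam : ∀ n (y : X), Metric.ediam (Metric.closedBall y (r n)) ≤ ENNReal.ofReal (2 * r n) := by
    intro n y
    rw [← Metric.closedEBall_ofReal (hr0 n).le, ENNReal.ofReal_mul zero_le_two,
      ENNReal.ofReal_ofNat]
    exact Metric.ediam_closedEBall_le
  have key := MeasureTheory.Measure.hausdorffMeasure_le_liminf_sum (ι := fun n => t n) (s : ℝ) F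
    (l := atTop) _ hrlim (fun n y => Metric.closedBall (y : X) (r n))
    (Eventually.of_forall fun n y => hdiam n y)
    (Eventually.of_forall fun n p hp => by
      obtain ⟨y, hy, hpy⟩ := mem_iUnion₂.1 (htF n ⟨hp, hFR hp⟩)
      exact mem_iUnion.2 ⟨⟨y, hy⟩, hpy⟩)
  -- The factors `(R / r n) ^ s` and `(2 * r n) ^ s` cancel the dependence on `n`.
  refine ne_top_of_le_ne_top (b := ENNReal.ofReal (C * (2 * R) ^ (s : ℝ))) ENNReal.ofReal_ne_top
    (key.trans ?_)
  refine (liminf_le_liminf (v := fun _ => ENNReal.ofReal (C * (2 * R) ^ (s : ℝ)))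
    (Eventually.of_forall fun n => ?_)).trans (by simp)
  calc ∑ y : t n, Metric.ediam (Metric.closedBall (y : X) (r n)) ^ (s : ℝ)
      ≤ ∑ _y : t n, ENNReal.ofReal (2 * r n) ^ (s : ℝ) :=
        Finset.sum_le_sum fun y _ => ENNReal.rpow_le_rpow (hdiam n y) s.coe_nonneg
    _ = ENNReal.ofReal ((t n).card * (2 * r n) ^ (s : ℝ)) := by
        rw [Finset.sum_const, Finset.card_univ, Fintype.card_coe, nsmul_eq_mul,
          ENNReal.ofReal_mul (Nat.cast_nonneg _), ENNReal.ofReal_natCast,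
          ENNReal.ofReal_rpow_of_nonneg (by linarith [hr0 n]) s.coe_nonneg]
    _ ≤ ENNReal.ofReal (C * (2 * R) ^ (s : ℝ)) := by
        apply ENNReal.ofReal_le_ofReal
        have h2 : (0 : ℝ) ≤ 2 * r n := by linarith [hr0 n]
        calc (t n).card * (2 * r n) ^ (s : ℝ)
            ≤ C * (R / r n) ^ (s : ℝ) * (2 * r n) ^ (s : ℝ) := by
              gcongr
              exact ht n
          _ = C * (2 * R) ^ (s : ℝ) := by
              rw [mul_assoc, ← Real.mul_rpow (div_nonneg hRpos.le (hr0 n).le) h2]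
              congr 2
              field_simp [(hr0 n).ne']

theorem dimH_le_assouadDim {X : Type*} [MetricSpace X] {F : Set X}
    (hF : Bornology.IsBounded F) : dimH F ≤ assouadDim F :=
  le_iInf₂ fun _ hs => dimH_le_of_isAssouadExponent hF hs

/-- Coverings by balls of radius `r` can be refined to coverings by balls of radius `r'`. -/
theorem exists_cover_refine {X : Type*} [PseudoMetricSpace X] {V A : Set X} {t : Finset X}
    {r r' N : ℝ} (htV : ↑t ⊆ V) (hAV : A ⊆ V) (hA : A ⊆ ⋃ y ∈ t, Metric.closedBall y r)
    (h : ∀ y ∈ V, ∃ u : Finset X, ↑u ⊆ V ∧ (u.card : ℝ) ≤ N ∧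
      V ∩ Metric.closedBall y r ⊆ ⋃ z ∈ u, Metric.closedBall z r') :
    ∃ u : Finset X, ↑u ⊆ V ∧ (u.card : ℝ) ≤ t.card * N ∧
      A ⊆ ⋃ z ∈ u, Metric.closedBall z r' := by
  classical
  choose! u huV hucard hu using h
  refine ⟨t.biUnion u, ?_, ?_, ?_⟩
  · intro z hz
    obtain ⟨y, hy, hzy⟩ := Finset.mem_biUnion.1 (Finset.mem_coe.1 hz)
    exact huV y (htV hy) hzy
  · calc ((t.biUnion u).card : ℝ) ≤ ((∑ y ∈ t, (u y).card : ℕ) : ℝ) :=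
          Nat.cast_le.2 Finset.card_biUnion_le
      _ = ∑ y ∈ t, ((u y).card : ℝ) := by push_cast; rfl
      _ ≤ ∑ _y ∈ t, N := Finset.sum_le_sum fun y hy => hucard y (htV hy)
      _ = t.card * N := by rw [Finset.sum_const, nsmul_eq_mul]
  · intro p hp
    obtain ⟨y, hy, hpy⟩ := mem_iUnion₂.1 (hA hp)
    obtain ⟨z, hz, hpz⟩ := mem_iUnion₂.1 (hu y (htV hy) ⟨hAV hp, hpy⟩)
    exact mem_iUnion₂.2 ⟨z, Finset.mem_biUnion.2 ⟨y, hy, hz⟩, hpz⟩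

/-- If at all small scales the balls of radius `R` can be covered by `ρ ^ (-s)` balls of radius
`ρ * R`, then `s` is an admissible exponent for the Assouad dimension. -/
theorem isAssouadExponent_of_local_cover {X : Type*} [PseudoMetricSpace X] {V : Set X}
    (hV : TotallyBounded V) {ρ R₁ : ℝ} {s : ℝ≥0} (hρ : 0 < ρ) (hρ1 : ρ < 1) (hR₁ : 0 < R₁)
    (h : ∀ x ∈ V, ∀ R : ℝ, 0 < R → R ≤ R₁ → ∃ t : Finset X, ↑t ⊆ V ∧
      (t.card : ℝ) ≤ (1 / ρ) ^ (s : ℝ) ∧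
      V ∩ Metric.closedBall x R ⊆ ⋃ y ∈ t, Metric.closedBall y (ρ * R)) :
    IsAssouadExponent V s := by
  classical
  set q : ℝ := (1 / ρ) ^ (s : ℝ) with hq
  have hq0 : 0 ≤ q := by positivity
  have hq1 : 1 ≤ q := Real.one_le_rpow (by rw [le_div_iff₀ hρ]; linarith) s.coe_nonneg
  have iter : ∀ k : ℕ, ∀ x ∈ V, ∀ R : ℝ, 0 < R → R ≤ R₁ → ∃ t : Finset X, ↑t ⊆ V ∧
      (t.card : ℝ) ≤ q ^ k ∧
      V ∩ Metric.closedBall x R ⊆ ⋃ y ∈ t, Metric.closedBall y (ρ ^ k * R) := by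
    intro k
    induction k with
    | zero =>
      intro x hx R hR hRR
      exact ⟨{x}, by simpa using hx, by simp, by simp⟩
    | succ k ih =>
      intro x hx R hR hRR
      obtain ⟨t, htV, htc, ht⟩ := ih x hx R hR hRR
      have hk : ρ ^ k * R ≤ R := mul_le_of_le_one_left hR.le (pow_le_one₀ hρ.le hρ1.le)
      obtain ⟨u, huV, huc, hu⟩ := exists_cover_refine htV inter_subset_left ht
        fun y hy => h y hy (ρ ^ k * R) (by positivity) (hk.trans hRR)
      refine ⟨u, huV, huc.trans ?_, ?_⟩
      · rw [pow_succ]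
        gcongr
      · rwa [← mul_assoc, ← pow_succ'] at hu
  have small : ∀ x ∈ V, ∀ r R : ℝ, 0 < r → r < R → R ≤ R₁ → ∃ t : Finset X, ↑t ⊆ V ∧
      (t.card : ℝ) ≤ q * (R / r) ^ (s : ℝ) ∧
      V ∩ Metric.closedBall x R ⊆ ⋃ y ∈ t, Metric.closedBall y r := by
    intro x hx r R hr hrR hRR
    have hR : 0 < R := hr.trans hrR
    have hex : ∃ k : ℕ, ρ ^ k * R ≤ r := by
      obtain ⟨k, hk⟩ := exists_pow_lt_of_lt_one (div_pos hr hR) hρ1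
      exact ⟨k, ((lt_div_iff₀ hR).1 hk).le⟩
    -- Stopping at the first power of `ρ` that reaches below `r` overshoots by at most one step,
    -- which costs the single factor `q`.
    obtain ⟨k, hk, hmin⟩ : ∃ k : ℕ, ρ ^ (k + 1) * R ≤ r ∧ r < ρ ^ k * R := by
      have h0 : Nat.find hex ≠ 0 := by
        intro h0
        have := Nat.find_spec hex
        rw [h0] at this
        linarith
      obtain ⟨k, hk⟩ := Nat.exists_eq_succ_of_ne_zero h0
      refine ⟨k, ?_, ?_⟩
      · have := Nat.find_spec hex
        rwa [hk] at this
      · exact not_le.1 (Nat.find_min hex (by omega))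
    obtain ⟨t, htV, htc, ht⟩ := iter (k + 1) x hx R hR hRR
    refine ⟨t, htV, htc.trans ?_, ht.trans ?_⟩
    · rw [pow_succ, mul_comm]
      gcongr
      rw [hq, ← Real.rpow_natCast, ← Real.rpow_mul (by positivity), mul_comm, Real.rpow_mul
        (by positivity), Real.rpow_natCast]
      gcongr
      rw [one_div, inv_pow, inv_le_comm₀ (by positivity) (by positivity), inv_div,
        div_le_iff₀ hR]
      exact hmin.le
    · exact iUnion₂_mono fun y _ => Metric.closedBall_subset_closedBall hk
  obtain ⟨t₀, ht₀V, ht₀fin, ht₀⟩ := Metric.finite_approx_of_totallyBounded hV R₁ hR₁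
  lift t₀ to Finset X using ht₀fin
  have ht₀' : V ⊆ ⋃ y ∈ t₀, Metric.closedBall y R₁ := ht₀.trans
    (iUnion₂_mono fun y _ => Metric.ball_subset_closedBall)
  -- A fixed net `t₀` at scale `R₁` handles all larger radii. The `+ 1` lets the same constant serve
  -- radii up to `R₁` without showing that `t₀` is nonempty.
  refine ⟨(t₀.card + 1) * q, fun x hx r R hr hrR => ?_⟩
  have hRr : 1 ≤ (R / r) ^ (s : ℝ) := Real.one_le_rpow (by rw [le_div_iff₀ hr]; linarith) s.coe_nonneg
  have hcard : (0 : ℝ) ≤ t₀.card := Nat.cast_nonneg _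
  have hR : 0 < R := hr.trans hrR
  rcases le_or_gt R R₁ with hRR | hRR
  · obtain ⟨t, -, htc, ht⟩ := small x hx r R hr hrR hRR
    refine ⟨t, htc.trans ?_, ht⟩
    rw [mul_assoc]
    exact le_mul_of_one_le_left (by positivity) (by linarith)
  · rcases le_or_gt R₁ r with hrR₁ | hrR₁
    · refine ⟨t₀, ?_, inter_subset_left.trans (ht₀'.trans
        (iUnion₂_mono fun y _ => Metric.closedBall_subset_closedBall hrR₁))⟩
      calc (t₀.card : ℝ) ≤ (t₀.card + 1) * 1 * 1 := by linarith
        _ ≤ (t₀.card + 1) * q * (R / r) ^ (s : ℝ) := by gcongr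
    · obtain ⟨u, -, huc, hu⟩ := exists_cover_refine ht₀V (inter_subset_left (t := Metric.closedBall x R))
        (inter_subset_left.trans ht₀') fun y hy => small y hy r R₁ hr hrR₁ le_rfl
      refine ⟨u, huc.trans ?_, hu⟩
      rw [← mul_assoc]
      gcongr
      linarith

/-- A bounded function that separates points which are not within distance `r` yields a covering by
balls of radius `r`. -/
theorem exists_cover_of_separating {X : Type*} [PseudoMetricSpace X] {S : Set X} {f : X → ℝ}
    {a L δ r : ℝ} (hδ : 0 < δ) (hL : 0 ≤ L) (hf : ∀ p ∈ S, f p ∈ Icc a (a + L))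
    (hr : ∀ p ∈ S, ∀ q ∈ S, |f p - f q| ≤ δ → dist p q ≤ r) :
    ∃ t : Finset X, ↑t ⊆ S ∧ (t.card : ℝ) ≤ L / δ + 1 ∧ S ⊆ ⋃ y ∈ t, Metric.closedBall y r := by
  classical
  obtain rfl | ⟨x₀, -⟩ := S.eq_empty_or_nonempty
  · exact ⟨∅, by simp, by simpa using by positivity, by simp⟩
  have : Nonempty X := ⟨x₀⟩
  -- Cut the range of `f` into bins of length `δ` and keep one point of `S` for each occupied bin.
  let c : X → ℕ := fun p => ⌊(f p - a) / δ⌋₊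
  have hc : ∀ p ∈ S, c p ∈ Finset.range (⌊L / δ⌋₊ + 1) := by
    intro p hp
    rw [Finset.mem_range, Nat.lt_succ_iff]
    apply Nat.floor_le_floor
    gcongr
    linarith [(hf p hp).2]
  let I := (Finset.range (⌊L / δ⌋₊ + 1)).filter fun n => ∃ p ∈ S, c p = n
  have hI : ∀ n ∈ I, ∃ p ∈ S, c p = n := fun n hn => (Finset.mem_filter.1 hn).2
  choose! g hgS hg using hI
  refine ⟨I.image g, ?_, ?_, ?_⟩
  · intro y hy
    obtain ⟨n, hn, rfl⟩ := Finset.mem_image.1 (Finset.mem_coe.1 hy)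
    exact hgS n hn
  · calc ((I.image g).card : ℝ) ≤ (⌊L / δ⌋₊ + 1 : ℕ) := by
          refine Nat.cast_le.2 (Finset.card_image_le.trans ((Finset.card_filter_le _ _).trans ?_))
          rw [Finset.card_range]
      _ ≤ L / δ + 1 := by
          push_cast
          linarith [Nat.floor_le (div_nonneg hL hδ.le)]
  · intro p hp
    have hpI : c p ∈ I := Finset.mem_filter.2 ⟨hc p hp, p, hp, rfl⟩
    refine mem_iUnion₂.2 ⟨g (c p), Finset.mem_image_of_mem g hpI, ?_⟩
    have hgp := hgS _ hpI
    apply hr p hp _ hgp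
    have h1 : c (g (c p)) = c p := hg _ hpI
    have e1 : 0 ≤ (f p - a) / δ := div_nonneg (by linarith [(hf p hp).1]) hδ.le
    have e2 : 0 ≤ (f (g (c p)) - a) / δ := div_nonneg (by linarith [(hf _ hgp).1]) hδ.le
    have a1 := Nat.floor_le e1
    have a2 := Nat.floor_le e2
    have b1 := Nat.lt_floor_add_one ((f p - a) / δ)
    have b2 := Nat.lt_floor_add_one ((f (g (c p)) - a) / δ)
    change ⌊(f (g (c p)) - a) / δ⌋₊ = ⌊(f p - a) / δ⌋₊ at h1
    rw [h1] at a2 b2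
    have h3 : (f p - f (g (c p))) / δ = (f p - a) / δ - (f (g (c p)) - a) / δ := by ring
    have h4 : |(f p - f (g (c p))) / δ| ≤ 1 := by
      rw [h3, abs_le]
      constructor <;> linarith
    rwa [abs_div, abs_of_pos hδ, div_le_one hδ] at h4

/-! ### Diagonal maps of the plane -/

theorem Plane.forall_eq_or {d d' : Fin 2} (h : d ≠ d') (i : Fin 2) : i = d ∨ i = d' := by
  omega

theorem Plane.sum_eq {d d' : Fin 2} (h : d ≠ d') (f : Fin 2 → ℝ) : ∑ i, f i = f d + f d' := by
  rw [Fin.sum_univ_two]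
  obtain ⟨rfl, rfl⟩ | ⟨rfl, rfl⟩ : d = 0 ∧ d' = 1 ∨ d = 1 ∧ d' = 0 := by omega
  · rfl
  · exact add_comm _ _

theorem Plane.norm_sq_eq {d d' : Fin 2} (h : d ≠ d') (p : Plane) :
    ‖p‖ ^ 2 = p d ^ 2 + p d' ^ 2 := by
  rw [EuclideanSpace.real_norm_sq_eq, Plane.sum_eq h]

theorem Plane.inner_eq {d d' : Fin 2} (h : d ≠ d') (p q : Plane) :
    inner ℝ p q = p d * q d + p d' * q d' := by
  rw [PiLp.inner_apply, Plane.sum_eq h]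
  simp [mul_comm]

theorem Plane.ext_of_ne {d d' : Fin 2} (h : d ≠ d') {p q : Plane} (h1 : p d = q d)
    (h2 : p d' = q d') : p = q := by
  ext i
  obtain rfl | rfl := Plane.forall_eq_or h i <;> assumption

theorem toEuclideanLin_apply_of_isDiag {M : Matrix (Fin 2) (Fin 2) ℝ} (hM : M.IsDiag) (p : Plane)
    (d : Fin 2) : Matrix.toEuclideanLin M p d = M d d * p d := by
  change (M.mulVec p.ofLp) d = _
  conv_lhs => rw [← hM.diagonal_diag]
  exact Matrix.mulVec_diagonal _ _ _

section Diagonal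

variable {T : Plane →ₗ[ℝ] Plane} {a : Fin 2 → ℝ}

theorem adjoint_comp_self_apply_of_diagonal (hT : ∀ p i, T p i = a i * p i) (p : Plane)
    (i : Fin 2) : (LinearMap.adjoint T ∘ₗ T) p i = a i ^ 2 * p i := by
  have hsymm : LinearMap.adjoint T = T := by
    symm
    rw [LinearMap.eq_adjoint_iff]
    intro x y
    rw [Plane.inner_eq zero_ne_one, Plane.inner_eq zero_ne_one]
    simp only [hT]
    ring
  rw [hsymm, LinearMap.comp_apply, hT, hT]
  ring

theorem exists_sq_eq_of_hasEigenvalue_of_diagonal (hT : ∀ p i, T p i = a i * p i) {μ : ℝ}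
    (hμ : Module.End.HasEigenvalue (LinearMap.adjoint T ∘ₗ T) μ) : ∃ i, a i ^ 2 = μ := by
  obtain ⟨x, hx⟩ := hμ.exists_hasEigenvector
  by_contra! hne
  apply hx.2
  ext i
  have h1 := congrArg (fun p : Plane => p i) hx.apply_eq_smul
  simp only [adjoint_comp_self_apply_of_diagonal hT, PiLp.smul_apply, smul_eq_mul] at h1
  have h2 : (a i ^ 2 - μ) * x i = 0 := by linarith
  simpa using (mul_eq_zero.1 h2).resolve_left (sub_ne_zero.2 (hne i))

/-- Squared singular values are eigenvalues of the diagonal map with entries `a i ^ 2`. The strict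
inequality forces the two indices to differ. -/
theorem exists_alpha_eq_of_diagonal (hT : ∀ p i, T p i = a i * p i) (hα : alpha₂ T < alpha₁ T) :
    ∃ d d', d ≠ d' ∧ alpha₁ T = |a d| ∧ alpha₂ T = |a d'| := by
  have key : ∀ n < 2, ∃ i, T.singularValues n = |a i| := by
    intro n hn
    obtain ⟨i, hi⟩ := exists_sq_eq_of_hasEigenvalue_of_diagonal hT
      (T.hasEigenvalue_adjoint_comp_self_sq_singularValues (n := n) (by simpa using hn))
    refine ⟨i, ?_⟩
    rw [← abs_of_nonneg (T.singularValues_nonneg n)]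
    exact ((sq_eq_sq_iff_abs_eq_abs _ _).1 hi).symm
  obtain ⟨d, hd⟩ := key 0 (by norm_num)
  obtain ⟨d', hd'⟩ := key 1 (by norm_num)
  refine ⟨d, d', ?_, hd, hd'⟩
  rintro rfl
  exact hα.ne (hd'.trans hd.symm)

theorem apply_eq_zero_of_mem_orientation₁ (hT : ∀ p i, T p i = a i * p i) {d d' : Fin 2}
    (hα : alpha₁ T = |a d|) (had : |a d'| < |a d|) {x : Plane} (hx : x ∈ orientation₁ T) :
    x d' = 0 := by
  obtain ⟨y, hy, rfl⟩ := Submodule.mem_map.1 hx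
  have h1 := congrArg (fun p : Plane => p d') (Module.End.mem_eigenspace_iff.1 hy)
  simp only [adjoint_comp_self_apply_of_diagonal hT, PiLp.smul_apply, smul_eq_mul, hα,
    sq_abs] at h1
  have h2 : (a d' ^ 2 - a d ^ 2) * y d' = 0 := by linarith
  rw [hT, (mul_eq_zero.1 h2).resolve_left (sub_ne_zero.2 (sq_lt_sq.2 had).ne), mul_zero]

/-- Guards against a junk value: for the zero submodule, `lineAngle` would be the infimum of the
empty set, which is `0` in `ℝ`, and the lower bound on angles would fail. -/
theorem exists_ne_zero_mem_orientation₁ (hT : ∀ p i, T p i = a i * p i) (ha : ∀ i, a i ≠ 0) :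
    ∃ x ∈ orientation₁ T, x ≠ 0 := by
  obtain ⟨x, hx⟩ := (T.hasEigenvalue_adjoint_comp_self_sq_singularValues
    (n := 0) (by simp)).exists_hasEigenvector
  refine ⟨T x, Submodule.mem_map_of_mem hx.1, fun h => hx.2 ?_⟩
  ext i
  have := congrArg (fun p : Plane => p i) h
  rw [hT] at this
  simpa [ha i] using this

end Diagonal

/-- A nonzero submodule contained in a coordinate axis makes an angle bounded below with each line
that is not that axis. -/
theorem arccos_le_lineAngle {d d' : Fin 2} (hd : d ≠ d') {L : Submodule ℝ Plane} {e : Plane}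
    (he : ‖e‖ = 1) (hL : ∀ x ∈ L, x d' = 0) (hL0 : ∃ x ∈ L, x ≠ 0) :
    Real.arccos |e d| ≤ lineAngle L (ℝ ∙ e) := by
  have he0 : e ≠ 0 := by
    rintro rfl
    simp at he
  apply le_csInf
  · obtain ⟨x, hx, hx0⟩ := hL0
    exact ⟨_, x, hx, e, Submodule.mem_span_singleton_self e, hx0, he0, rfl⟩
  · rintro _ ⟨x, hx, y, hy, hx0, hy0, rfl⟩
    obtain ⟨t, rfl⟩ := Submodule.mem_span_singleton.1 hy
    apply Real.arccos_le_arccos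
    have hxn : ‖x‖ = |x d| := by
      rw [← abs_of_nonneg (norm_nonneg x)]
      apply (sq_eq_sq_iff_abs_eq_abs _ _).1
      rw [Plane.norm_sq_eq hd, hL x hx]
      ring
    have hx1 : 0 < ‖x‖ := norm_pos_iff.2 hx0
    have hy1 : 0 < ‖t • e‖ := norm_pos_iff.2 hy0
    rw [div_le_iff₀ (by positivity), Plane.inner_eq hd, hL x hx, norm_smul, he, hxn]
    calc x d * (t • e) d + 0 * (t • e) d' = x d * (t * e d) := by simp
      _ ≤ |x d * (t * e d)| := le_abs_self _
      _ = |e d| * (|x d| * (‖t‖ * 1)) := by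
        rw [abs_mul, abs_mul, Real.norm_eq_abs]
        ring

/-! ### Self-affine carpets -/

namespace AffineIFS

variable {κ : ℕ} {Φ : AffineIFS κ} {E : Set Plane}

/-- The product of the `d`-th diagonal entries along a word. -/
def diagProd (Φ : AffineIFS κ) (d : Fin 2) (w : List (Fin κ)) : ℝ :=
  (w.map fun i => Φ.A i d d).prod

@[simp] theorem diagProd_nil (d : Fin 2) : Φ.diagProd d [] = 1 := rfl

@[simp] theorem diagProd_cons (d : Fin 2) (i : Fin κ) (w : List (Fin κ)) :
    Φ.diagProd d (i :: w) = Φ.A i d d * Φ.diagProd d w := by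
  simp [diagProd]

@[simp] theorem diagProd_append (d : Fin 2) (v w : List (Fin κ)) :
    Φ.diagProd d (v ++ w) = Φ.diagProd d v * Φ.diagProd d w := by
  simp [diagProd]

@[simp] theorem diagProd_replicate (d : Fin 2) (n : ℕ) (i : Fin κ) :
    Φ.diagProd d (List.replicate n i) = Φ.A i d d ^ n := by
  simp [diagProd]

theorem wordLin_apply (hcarpet : Φ.IsCarpet) (w : List (Fin κ)) (p : Plane) (d : Fin 2) :
    Φ.wordLin w p d = Φ.diagProd d w * p d := by
  induction w generalizing p with
  | nil => simp [wordLin]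
  | cons i w ih =>
    have : Φ.wordLin (i :: w) p = Matrix.toEuclideanLin (Φ.A i) (Φ.wordLin w p) := by
      simp [wordLin, Matrix.toLpLin_apply]
    rw [this, toEuclideanLin_apply_of_isDiag (hcarpet i), ih, diagProd_cons, mul_assoc]

theorem wordMap_sub_wordMap (hcarpet : Φ.IsCarpet) (w : List (Fin κ)) (p q : Plane) (d : Fin 2) :
    Φ.wordMap w p d - Φ.wordMap w q d = Φ.diagProd d w * (p d - q d) := by
  induction w with
  | nil => simp [wordMap]
  | cons i w ih =>
    rw [diagProd_cons, mul_assoc, ← ih]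
    simp only [wordMap, Function.comp_apply, map, PiLp.add_apply,
      toEuclideanLin_apply_of_isDiag (hcarpet i)]
    ring

theorem diag_ne_zero (hcarpet : Φ.IsCarpet) (i : Fin κ) (d : Fin 2) : Φ.A i d d ≠ 0 := by
  have h := (Matrix.isUnit_iff_isUnit_det _).1 (Φ.invertible i)
  rw [← (hcarpet i).diagonal_diag, Matrix.det_diagonal] at h
  exact Finset.prod_ne_zero_iff.1 h.ne_zero d (Finset.mem_univ d)

theorem diagProd_ne_zero (hcarpet : Φ.IsCarpet) (d : Fin 2) (w : List (Fin κ)) :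
    Φ.diagProd d w ≠ 0 := by
  induction w with
  | nil => simp
  | cons i w ih => simp [ih, diag_ne_zero hcarpet]

theorem abs_diag_lt_one (hcarpet : Φ.IsCarpet) (i : Fin κ) (d : Fin 2) : |Φ.A i d d| < 1 := by
  obtain ⟨K, hK⟩ := Φ.contractive i
  have h := hK.2.dist_le_mul (EuclideanSpace.single d 1) 0
  rw [map_zero, dist_zero_right, dist_zero_right] at h
  have h1 := PiLp.norm_apply_le (Matrix.toEuclideanLin (Φ.A i) (EuclideanSpace.single d (1 : ℝ))) d
  rw [toEuclideanLin_apply_of_isDiag (hcarpet i)] at h1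
  simp only [PiLp.single_apply, if_true, mul_one, Real.norm_eq_abs, PiLp.norm_single,
    abs_one] at h h1
  exact (h1.trans h).trans_lt hK.1

theorem exists_diag_bounds [Nonempty (Fin κ)] (hcarpet : Φ.IsCarpet) (d : Fin 2) :
    ∃ b B : ℝ, 0 < b ∧ b < 1 ∧ 0 < B ∧ B < 1 ∧ ∀ i, b ≤ |Φ.A i d d| ∧ |Φ.A i d d| ≤ B := by
  obtain ⟨i, hi⟩ := Finite.exists_min fun i => |Φ.A i d d|
  obtain ⟨j, hj⟩ := Finite.exists_max fun i => |Φ.A i d d|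
  exact ⟨_, _, abs_pos.2 (diag_ne_zero hcarpet i d), abs_diag_lt_one hcarpet i d,
    abs_pos.2 (diag_ne_zero hcarpet j d), abs_diag_lt_one hcarpet j d, fun k => ⟨hi k, hj k⟩⟩

theorem pow_le_abs_diagProd {d : Fin 2} {b : ℝ} (hb : 0 ≤ b) (h : ∀ i, b ≤ |Φ.A i d d|)
    (w : List (Fin κ)) : b ^ w.length ≤ |Φ.diagProd d w| := by
  induction w with
  | nil => simp
  | cons i w ih =>
    rw [List.length_cons, diagProd_cons, abs_mul, pow_succ']
    exact mul_le_mul (h i) ih (by positivity) (abs_nonneg _)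

theorem IsSelfAffineSet.wordMap_image_subset (hE : Φ.IsSelfAffineSet E) (w : List (Fin κ)) :
    Φ.wordMap w '' E ⊆ E := by
  induction w with
  | nil => simp [wordMap]
  | cons i w ih =>
    rw [wordMap, image_comp]
    refine (image_mono ih).trans ?_
    conv_rhs => rw [hE.2.2]
    exact subset_iUnion (fun i => Φ.map i '' E) i

theorem wordMap_append (v w : List (Fin κ)) (p : Plane) :
    Φ.wordMap (v ++ w) p = Φ.wordMap v (Φ.wordMap w p) := by
  induction v with
  | nil => rfl
  | cons i v ih => simp [wordMap, ih]

theorem IsSelfAffineSet.nonempty_index (hE : Φ.IsSelfAffineSet E) : Nonempty (Fin κ) := by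
  obtain ⟨x, hx⟩ := hE.1
  rw [hE.2.2] at hx
  exact ⟨(mem_iUnion.1 hx).choose⟩

/-- Each point of the set lies in a cylinder whose extent in the coordinate `d` is comparable to
a prescribed number. -/
theorem IsSelfAffineSet.exists_wordMap_diagProd_le (hE : Φ.IsSelfAffineSet E) {d : Fin 2}
    {b B : ℝ} (hb : 0 < b) (hB : 0 < B) (hB1 : B < 1)
    (h : ∀ i, b ≤ |Φ.A i d d| ∧ |Φ.A i d d| ≤ B) {δ : ℝ} (hδ : 0 < δ) (hδ1 : δ < 1) {p : Plane}
    (hp : p ∈ E) :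
    ∃ w, p ∈ Φ.wordMap w '' E ∧ b * δ ≤ |Φ.diagProd d w| ∧ |Φ.diagProd d w| ≤ δ := by
  -- Lengthen the address of `p` letter by letter until the product first drops to `δ`. One letter
  -- shrinks it by a factor of at least `b`, so it lands above `b * δ`. The second alternative means
  -- that it has not dropped yet, which `B ^ n` eventually rules out.
  have step : ∀ n : ℕ, ∃ w, p ∈ Φ.wordMap w '' E ∧
      (b * δ ≤ |Φ.diagProd d w| ∧ |Φ.diagProd d w| ≤ δ ∨
        δ < |Φ.diagProd d w| ∧ |Φ.diagProd d w| ≤ B ^ n) := by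
    intro n
    induction n with
    | zero => exact ⟨[], by simpa [wordMap] using hp, Or.inr (by simpa using hδ1)⟩
    | succ n ih =>
      obtain ⟨w, hw, hw' | ⟨hw1, hw2⟩⟩ := ih
      · exact ⟨w, hw, Or.inl hw'⟩
      · obtain ⟨q, hq, rfl⟩ := hw
        rw [hE.2.2] at hq
        obtain ⟨i, q', hq', rfl⟩ := mem_iUnion.1 hq
        refine ⟨w ++ [i], ⟨q', hq', ?_⟩, ?_⟩
        · rw [wordMap_append]
          rfl
        · simp only [diagProd_append, diagProd_cons, diagProd_nil, mul_one, abs_mul]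
          rcases le_or_gt (|Φ.diagProd d w| * |Φ.A i d d|) δ with hle | hlt
          · refine Or.inl ⟨?_, hle⟩
            rw [mul_comm]
            exact mul_le_mul hw1.le (h i).1 hb.le (abs_nonneg _)
          · refine Or.inr ⟨hlt, ?_⟩
            rw [pow_succ]
            exact mul_le_mul hw2 (h i).2 (abs_nonneg _) (by positivity)
  obtain ⟨n, hn⟩ := exists_pow_lt_of_lt_one hδ hB1
  obtain ⟨w, hw, hw' | ⟨hw1, hw2⟩⟩ := step n
  · exact ⟨w, hw, hw'⟩
  · linarith

theorem IsDominated.exists_diagProd (hcarpet : Φ.IsCarpet) (hdom : Φ.IsDominated) :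
    ∃ τ : ℝ, 1 < τ ∧ ∃ n₀ : ℕ, ∀ w : List (Fin κ), n₀ ≤ w.length →
      alpha₂ (Φ.wordLin w) < alpha₁ (Φ.wordLin w) ∧
      ∃ d d', d ≠ d' ∧ alpha₁ (Φ.wordLin w) = |Φ.diagProd d w| ∧
        τ ^ w.length * |Φ.diagProd d' w| < |Φ.diagProd d w| := by
  obtain ⟨τ, hτ, n₀, h⟩ := hdom
  refine ⟨τ, hτ, n₀, fun w hw => ?_⟩
  have h1 := h w hw
  have h2 : alpha₂ (Φ.wordLin w) < alpha₁ (Φ.wordLin w) :=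
    (le_mul_of_one_le_left ((Φ.wordLin w).singularValues_nonneg 1)
      (one_le_pow₀ hτ.le)).trans_lt h1
  obtain ⟨d, d', hd, e1, e2⟩ := exists_alpha_eq_of_diagonal (a := fun i => Φ.diagProd i w)
    (wordLin_apply hcarpet w) h2
  rw [e1, e2] at h1
  exact ⟨h2, d, d', hd, e1, h1⟩

/-- In a dominated carpet the same coordinate dominates for all long words. -/
theorem IsDominated.exists_dominant_coordinate (hcarpet : Φ.IsCarpet) (hdom : Φ.IsDominated) :
    ∃ d d' : Fin 2, d ≠ d' ∧ ∃ τ : ℝ, 1 < τ ∧ ∃ n₀ : ℕ, ∀ w : List (Fin κ), n₀ ≤ w.length →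
      alpha₁ (Φ.wordLin w) = |Φ.diagProd d w| ∧
        τ ^ w.length * |Φ.diagProd d' w| < |Φ.diagProd d w| := by
  obtain ⟨τ, hτ, n₀, h⟩ := hdom.exists_diagProd hcarpet
  have hτ0 : 0 < τ := by linarith
  have hτn : ∀ n : ℕ, 1 ≤ τ ^ n := fun n => one_le_pow₀ hτ.le
  have hle : ∀ (n : ℕ) (x : ℝ), |x| ≤ τ ^ n * |x| := fun n x =>
    le_mul_of_one_le_left (abs_nonneg x) (hτn n)
  have hor : ∀ {d d' : Fin 2}, d ≠ d' → ∀ w : List (Fin κ), n₀ ≤ w.length →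
      (τ ^ w.length * |Φ.diagProd d' w| < |Φ.diagProd d w|) ∨
      (τ ^ w.length * |Φ.diagProd d w| < |Φ.diagProd d' w|) := by
    intro d d' hd w hw
    obtain ⟨-, f, f', hf, -, h1⟩ := h w hw
    obtain ⟨rfl, rfl⟩ | ⟨rfl, rfl⟩ : f = d ∧ f' = d' ∨ f = d' ∧ f' = d := by omega
    · exact Or.inl h1
    · exact Or.inr h1
  have concl : ∀ {d d' : Fin 2}, d ≠ d' → (∀ i, |Φ.A i d' d'| ≤ |Φ.A i d d|) →
      ∀ w : List (Fin κ), n₀ ≤ w.length → alpha₁ (Φ.wordLin w) = |Φ.diagProd d w| ∧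
        τ ^ w.length * |Φ.diagProd d' w| < |Φ.diagProd d w| := by
    intro d d' hd hall w hw
    have hmono : |Φ.diagProd d' w| ≤ |Φ.diagProd d w| := by
      clear hw
      induction w with
      | nil => simp
      | cons i w ih =>
        simp only [diagProd_cons, abs_mul]
        exact mul_le_mul (hall i) ih (abs_nonneg _) (abs_nonneg _)
    obtain ⟨-, f, f', hf, hα, h1⟩ := h w hw
    obtain ⟨rfl, rfl⟩ | ⟨rfl, rfl⟩ : f = d ∧ f' = d' ∨ f = d' ∧ f' = d := by omega
    · exact ⟨hα, h1⟩
    · linarith [hle w.length (Φ.diagProd f' w)]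
  by_cases hall : ∀ i, |Φ.A i 1 1| ≤ |Φ.A i 0 0|
  · exact ⟨0, 1, zero_ne_one, τ, hτ, n₀, concl zero_ne_one hall⟩
  push Not at hall
  obtain ⟨j, hj⟩ := hall
  refine ⟨1, 0, one_ne_zero, τ, hτ, n₀, concl one_ne_zero fun i => ?_⟩
  by_contra! hi
  set p := |Φ.A i 0 0|
  set q := |Φ.A i 1 1| with hq
  set r := |Φ.A j 0 0| with hr
  set s := |Φ.A j 1 1|
  have hq0 : 0 < q := abs_pos.2 (diag_ne_zero hcarpet i 1)
  have hr0 : 0 < r := abs_pos.2 (diag_ne_zero hcarpet j 0)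
  -- Letter `i` favours coordinate `0` and letter `j` coordinate `1`. Replacing one `j` by `i`
  -- divides the ratio of the two diagonal products by `s * p / (q * r)`, whatever the length; `n`
  -- is so large that `τ ^ n` exceeds this.
  obtain ⟨m, hm⟩ := pow_unbounded_of_one_lt (s * p / (q * r)) hτ
  set n := max m n₀ with hn
  have hmn : s * p < τ ^ n * (q * r) := by
    rw [← div_lt_iff₀ (by positivity)]
    exact hm.trans_le (pow_le_pow_right₀ hτ.le (le_max_left _ _))
  -- Discrete continuity along the words `i ^ k j ^ (n - k)`: domination forbids ratios between `τ ^
  -- (-n)` and `τ ^ n`, and a single replacement cannot jump that gap. So coordinate `1` still wins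
  -- at `i ^ n`, against the choice of `i`.
  have claim : ∀ k ≤ n, τ ^ n * |Φ.diagProd 0 (List.replicate k i ++ List.replicate (n - k) j)| <
      |Φ.diagProd 1 (List.replicate k i ++ List.replicate (n - k) j)| := by
    intro k
    induction k with
    | zero =>
      intro _
      have := hor (d := 0) (d' := 1) zero_ne_one (List.replicate n j) (by simp [hn])
      simp only [List.length_replicate] at this
      refine Or.resolve_left (by simpa using this) fun h0 => ?_
      have h2 : r ^ n ≤ s ^ n := pow_le_pow_left₀ hr0.le hj.le n
      have h3 := hle n (Φ.A j 1 1 ^ n)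
      rw [abs_pow] at h3
      have h4 : τ ^ n * s ^ n < r ^ n := h0
      change s ^ n ≤ τ ^ n * s ^ n at h3
      linarith
    | succ k ih =>
      intro hk
      have ih := ih (by omega)
      have h1 := hor (d := 0) (d' := 1) zero_ne_one
        (List.replicate (k + 1) i ++ List.replicate (n - (k + 1)) j)
        (by simp only [List.length_append, List.length_replicate]; omega)
      have hlen : (List.replicate (k + 1) i ++ List.replicate (n - (k + 1)) j).length = n := by
        simp only [List.length_append, List.length_replicate]; omega
      rw [hlen] at h1
      refine h1.resolve_left fun h2 => ?_
      obtain ⟨l, hl⟩ : ∃ l, n = k + 1 + l := ⟨n - (k + 1), by omega⟩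
      have e1 : n - (k + 1) = l := by omega
      have e2 : n - k = l + 1 := by omega
      rw [e1] at h2
      rw [e2] at ih
      simp only [diagProd_append, diagProd_replicate, abs_mul, abs_pow, pow_succ _ k,
        pow_succ _ l] at ih h2
      change τ ^ n * (p ^ k * (r ^ l * r)) < q ^ k * (s ^ l * s) at ih
      change τ ^ n * (q ^ k * q * s ^ l) < p ^ k * p * r ^ l at h2
      have hp0 : 0 < p := hq0.trans hi
      have hs0 : 0 < s := hr0.trans hj
      have h3 : p ^ k * r ^ l * r ≤ τ ^ n * (p ^ k * (r ^ l * r)) := by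
        rw [mul_assoc (p ^ k)]
        exact le_mul_of_one_le_left (by positivity) (hτn n)
      have h4 : (p ^ k * r ^ l * r) * p < (q ^ k * s ^ l * s) * p := by
        apply mul_lt_mul_of_pos_right _ hp0
        linarith
      have h5 : (τ ^ n * (q ^ k * q * s ^ l)) * r < (p ^ k * p * r ^ l) * r :=
        mul_lt_mul_of_pos_right h2 hr0
      have h6 : (q ^ k * s ^ l) * (s * p) < (q ^ k * s ^ l) * (τ ^ n * (q * r)) :=
        mul_lt_mul_of_pos_left hmn (by positivity)
      nlinarith
  have h1 := claim n le_rfl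
  simp only [Nat.sub_self, List.replicate_zero, List.append_nil, diagProd_replicate, abs_pow] at h1
  change τ ^ n * p ^ n < q ^ n at h1
  have h2 : q ^ n ≤ p ^ n := pow_le_pow_left₀ hq0.le hi.le n
  have h3 : p ^ n ≤ τ ^ n * p ^ n := le_mul_of_one_le_left (by positivity) (hτn n)
  linarith

/-- The orientations of all long words lie in the `d`-axis, so their angle to `e` never drops below
`arccos |e d|`, which is positive because `e` is off that axis. -/
theorem span_notMem_limitOrientations (hcarpet : Φ.IsCarpet) {d d' : Fin 2} (hd : d ≠ d') {n₀ : ℕ}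
    (h : ∀ w : List (Fin κ), n₀ ≤ w.length → alpha₁ (Φ.wordLin w) = |Φ.diagProd d w| ∧
      |Φ.diagProd d' w| < |Φ.diagProd d w|) {e : Plane} (he : ‖e‖ = 1) (hed : e d' ≠ 0) :
    (ℝ ∙ e) ∉ Φ.limitOrientations := by
  rintro ⟨-, j, hj⟩
  have hpos : 0 < Real.arccos |e d| := by
    rw [Real.arccos_pos]
    have h1 := Plane.norm_sq_eq hd e
    have h2 : 0 < e d' ^ 2 := by positivity
    rw [he] at h1
    rw [← abs_one, ← sq_lt_sq]
    linarith
  refine hpos.not_ge (ge_of_tendsto hj (eventually_atTop.2 ⟨n₀, fun n hn => ?_⟩))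
  have hw := h (List.ofFn fun k : Fin n => j k) (by simpa using hn)
  exact arccos_le_lineAngle hd he
    (fun x hx => apply_eq_zero_of_mem_orientation₁ (a := fun i => Φ.diagProd i _)
      (wordLin_apply hcarpet _) hw.1 hw.2 hx)
    (exists_ne_zero_mem_orientation₁ (a := fun i => Φ.diagProd i _) (wordLin_apply hcarpet _)
      fun i => diagProd_ne_zero hcarpet i _)

end AffineIFS

/-! ### Visible parts -/

theorem projAlong_eq_zero_of_mem {e p : Plane} (hp : p ∈ ℝ ∙ e) : projAlong e p = 0 :=
  Submodule.starProjection_orthogonal_apply_eq_zero hp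

theorem projAlong_add_smul (e p : Plane) (t : ℝ) : projAlong e (p + t • e) = projAlong e p := by
  rw [map_add, projAlong_eq_zero_of_mem (Submodule.smul_mem _ t
    (Submodule.mem_span_singleton_self e)), add_zero]

theorem exists_projAlong_add_smul_eq (e p : Plane) : ∃ t : ℝ, projAlong e p + t • e = p := by
  have h : p - projAlong e p ∈ (ℝ ∙ e)ᗮᗮ := Submodule.sub_starProjection_mem_orthogonal p
  rw [Submodule.orthogonal_orthogonal] at h
  obtain ⟨t, ht⟩ := Submodule.mem_span_singleton.1 h
  exact ⟨t, by rw [ht]; abel⟩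

/-- The linear functional that vanishes at `e`, in terms of the coordinates `d` and `d'`. -/
noncomputable def crossCoord (d d' : Fin 2) (e : Plane) : Plane →L[ℝ] ℝ :=
  e d' • EuclideanSpace.proj d - e d • EuclideanSpace.proj d'

/-- The linear functional with the value one at `e` that depends on the coordinate `d'` only. -/
noncomputable def heightCoord (d' : Fin 2) (e : Plane) : Plane →L[ℝ] ℝ :=
  (e d')⁻¹ • EuclideanSpace.proj d'

section Coordinates

variable {d d' : Fin 2} {e : Plane}

theorem crossCoord_apply (p : Plane) : crossCoord d d' e p = e d' * p d - e d * p d' := rfl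

theorem heightCoord_apply (p : Plane) : heightCoord d' e p = (e d')⁻¹ * p d' := rfl

theorem crossCoord_self : crossCoord d d' e e = 0 := by
  rw [crossCoord_apply]
  ring

theorem heightCoord_self (he : e d' ≠ 0) : heightCoord d' e e = 1 := inv_mul_cancel₀ he

theorem eq_add_smul_of_crossCoord_eq (hd : d ≠ d') (he : e d' ≠ 0) {p q : Plane}
    (h : crossCoord d d' e p = crossCoord d d' e q) :
    p = q + (heightCoord d' e p - heightCoord d' e q) • e := by
  simp only [crossCoord_apply] at h
  apply Plane.ext_of_ne hd
  · simp only [heightCoord_apply, PiLp.add_apply, PiLp.smul_apply, smul_eq_mul]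
    field_simp
    linarith
  · simp only [heightCoord_apply, PiLp.add_apply, PiLp.smul_apply, smul_eq_mul]
    field_simp
    ring

theorem Plane.abs_coord_sub_le (p q : Plane) (i : Fin 2) : |p i - q i| ≤ dist p q := by
  rw [dist_eq_norm]
  exact PiLp.norm_apply_le (p - q) i

theorem Plane.abs_coord_le_one (he : ‖e‖ = 1) (i : Fin 2) : |e i| ≤ 1 :=
  he ▸ PiLp.norm_apply_le e i

theorem abs_crossCoord_sub_le (he : ‖e‖ = 1) (p q : Plane) :
    |crossCoord d d' e p - crossCoord d d' e q| ≤ 2 * dist p q := by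
  have h : crossCoord d d' e p - crossCoord d d' e q = e d' * (p d - q d) - e d * (p d' - q d') := by
    simp only [crossCoord_apply]
    ring
  rw [h]
  refine (abs_sub _ _).trans ?_
  rw [abs_mul, abs_mul, two_mul]
  exact add_le_add
    (mul_le_of_le_one_left (abs_nonneg _) (Plane.abs_coord_le_one he _) |>.trans
      (Plane.abs_coord_sub_le p q d))
    (mul_le_of_le_one_left (abs_nonneg _) (Plane.abs_coord_le_one he _) |>.trans
      (Plane.abs_coord_sub_le p q d'))

theorem abs_heightCoord_sub_eq (p q : Plane) :
    |heightCoord d' e p - heightCoord d' e q| = |e d'|⁻¹ * |p d' - q d'| := by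
  rw [heightCoord_apply, heightCoord_apply, ← mul_sub, abs_mul, abs_inv]

/-- The two functionals are linear coordinates on the plane as long as `e` is off the `d`-axis; the
constant blows up as `e` approaches it. -/
theorem dist_le_crossCoord_add_heightCoord (hd : d ≠ d') (he : ‖e‖ = 1) (hed : e d' ≠ 0)
    (p q : Plane) :
    dist p q ≤ 2 * |e d'|⁻¹ * (|crossCoord d d' e p - crossCoord d d' e q| +
      |heightCoord d' e p - heightCoord d' e q|) := by
  set u := crossCoord d d' e p - crossCoord d d' e q with hu
  set v := heightCoord d' e p - heightCoord d' e q with hv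
  have h0 : 0 < |e d'| := abs_pos.2 hed
  have hinv : 1 ≤ |e d'|⁻¹ := (one_le_inv₀ h0).2 (Plane.abs_coord_le_one he _)
  have h1 : p d' - q d' = v * e d' := by
    rw [hv, heightCoord_apply, heightCoord_apply]
    field_simp
  have h2 : p d - q d = (e d')⁻¹ * u + v * e d := by
    rw [hv, hu, heightCoord_apply, heightCoord_apply, crossCoord_apply, crossCoord_apply]
    field_simp
    ring
  have h3 : |p d' - q d'| ≤ |v| := by
    rw [h1, abs_mul]
    exact mul_le_of_le_one_right (abs_nonneg _) (Plane.abs_coord_le_one he _)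
  have h4 : |p d - q d| ≤ |e d'|⁻¹ * |u| + |v| := by
    rw [h2]
    refine (abs_add_le _ _).trans ?_
    rw [abs_mul, abs_mul, abs_inv]
    gcongr
    exact mul_le_of_le_one_right (abs_nonneg _) (Plane.abs_coord_le_one he _)
  have h5 : dist p q ≤ |p d - q d| + |p d' - q d'| := by
    rw [dist_eq_norm]
    apply le_of_sq_le_sq _ (by positivity)
    rw [Plane.norm_sq_eq hd, PiLp.sub_apply, PiLp.sub_apply, ← sq_abs (p d - q d),
      ← sq_abs (p d' - q d')]
    nlinarith [mul_nonneg (abs_nonneg (p d - q d)) (abs_nonneg (p d' - q d'))]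
  have h6 : |v| ≤ |e d'|⁻¹ * |v| := le_mul_of_one_le_left (abs_nonneg _) hinv
  have h7 : 0 ≤ |e d'|⁻¹ * |u| := by positivity
  linarith

/-- The functional kills `e`, so it factors through the projection, and a linear image of a segment
in `ℝ` is an interval. -/
theorem ordConnected_crossCoord_image {S : Set Plane}
    (h : IsNontrivialInterval (projAlong e '' S)) : (crossCoord d d' e '' S).OrdConnected := by
  obtain ⟨a, b, -, hab⟩ := h
  have h1 : crossCoord d d' e '' S = crossCoord d d' e '' (projAlong e '' S) := by
    rw [image_image]
    refine image_congr fun p _ => ?_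
    obtain ⟨t, ht⟩ := exists_projAlong_add_smul_eq e p
    conv_lhs => rw [← ht]
    rw [map_add, map_smul, crossCoord_self, smul_zero, add_zero]
  rw [h1, hab]
  exact ((convex_segment a b).is_linear_image
    (crossCoord d d' e).toLinearMap.isLinear).ordConnected

end Coordinates

section Visible

variable {d d' : Fin 2} {e : Plane} {E : Set Plane}

theorem visiblePart_subset (E : Set Plane) (e : Plane) : visiblePart E e ⊆ E := by
  intro p hp
  have h : p ∈ (({p} : Set Plane) + halfLine e) ∩ E := by
    rw [show _ = _ from hp]
    rfl
  exact h.2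

/-- A higher point of `E` on the same line would lie on the ray from `p` and block it. -/
theorem heightCoord_le_of_mem_visiblePart (hd : d ≠ d') (he : e d' ≠ 0) {p q : Plane}
    (hp : p ∈ visiblePart E e) (hq : q ∈ E) (h : crossCoord d d' e q = crossCoord d d' e p) :
    heightCoord d' e q ≤ heightCoord d' e p := by
  by_contra! hlt
  have hqp := eq_add_smul_of_crossCoord_eq hd he h
  have hmem : q ∈ (({p} : Set Plane) + halfLine e) ∩ E := by
    refine ⟨?_, hq⟩
    rw [singleton_add]
    exact ⟨_, ⟨_, (sub_pos.2 hlt).le, rfl⟩, hqp.symm⟩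
  rw [show _ = _ from hp] at hmem
  rw [mem_singleton_iff.1 hmem] at hlt
  exact lt_irrefl _ hlt

/-- By compactness `E` has a highest point on the line through `p` in direction `e`, and nothing
blocks that point. -/
theorem exists_add_smul_mem_visiblePart (hd : d ≠ d') (he : e d' ≠ 0) (hE : IsCompact E)
    {p : Plane} (hp : p ∈ E) : ∃ t : ℝ, p + t • e ∈ visiblePart E e := by
  have hcomp : IsCompact (E ∩ crossCoord d d' e ⁻¹' {crossCoord d d' e p}) :=
    hE.inter_right (isClosed_singleton.preimage (crossCoord d d' e).continuous)
  obtain ⟨q, ⟨hqE, hq⟩, hmax⟩ := hcomp.exists_isMaxOn ⟨p, hp, rfl⟩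
    (heightCoord d' e).continuous.continuousOn
  have hqp := eq_add_smul_of_crossCoord_eq hd he (mem_singleton_iff.1 hq)
  refine ⟨heightCoord d' e q - heightCoord d' e p, ?_⟩
  rw [← hqp]
  refine Subset.antisymm ?_ ?_
  · rw [singleton_add]
    rintro _ ⟨⟨_, ⟨t, ht, rfl⟩, rfl⟩, hmem⟩
    have h1 : heightCoord d' e (q + t • e) ≤ heightCoord d' e q := by
      refine hmax ⟨hmem, ?_⟩
      rw [mem_preimage, map_add, map_smul, crossCoord_self, smul_zero, add_zero]
      exact hq
    rw [map_add, map_smul, heightCoord_self he, smul_eq_mul, mul_one] at h1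
    have h2 : t = 0 := by linarith
    simp [h2]
  · rintro _ rfl
    refine ⟨?_, hqE⟩
    rw [singleton_add]
    exact ⟨0, ⟨0, le_rfl, by simp⟩, add_zero _⟩

/-- A visible part has dimension at least one if some part of the set projects to an interval. -/
theorem one_le_dimH_visiblePart (hd : d ≠ d') (he : e d' ≠ 0) (hE : IsCompact E) {S : Set Plane}
    (hS : S ⊆ E) (hint : IsNontrivialInterval (projAlong e '' S)) :
    1 ≤ dimH (visiblePart E e) := by
  obtain ⟨a, b, hab, heq⟩ := hint
  have hsub : segment ℝ a b ⊆ projAlong e '' visiblePart E e := by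
    rw [← heq]
    rintro _ ⟨p, hp, rfl⟩
    obtain ⟨t, ht⟩ := exists_add_smul_mem_visiblePart hd he hE (hS hp)
    exact ⟨_, ht, projAlong_add_smul e p t⟩
  calc 1 = dimH (segment ℝ a b) := (Real.dimH_segment hab).symm
    _ ≤ dimH (projAlong e '' visiblePart E e) := dimH_mono hsub
    _ ≤ dimH (visiblePart E e) := (projAlong e).lipschitz.dimH_image_le _

/-- Covering an approximately monotone set. -/
theorem exists_cover_of_almost_antitone {X : Type*} [PseudoMetricSpace X] {A : Set X}
    {u v : X → ℝ} {a L δ K : ℝ} (hδ : 0 < δ) (hK : 0 ≤ K) (hL : 0 ≤ L)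
    (hdist : ∀ p q, dist p q ≤ K * (|u p - u q| + |v p - v q|))
    (hrange : ∀ p ∈ A, u p - v p ∈ Icc a (a + L))
    (hanti : ∀ p ∈ A, ∀ q ∈ A, u q ≤ u p → v p ≤ v q + δ) :
    ∃ t : Finset X, ↑t ⊆ A ∧ (t.card : ℝ) ≤ L / δ + 1 ∧
      A ⊆ ⋃ y ∈ t, Metric.closedBall y (K * (3 * δ)) := by
  -- If `u` increases, `v` increases by at most `δ`, so the changes of `u` and `-v` hardly cancel in
  -- `u - v`. A change of at most `δ` there forces one of at most `2 * δ` in `u` and `δ` in `v`.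
  apply exists_cover_of_separating (f := fun p => u p - v p) hδ hL hrange
  have key : ∀ p ∈ A, ∀ q ∈ A, u q ≤ u p → |(u p - v p) - (u q - v q)| ≤ δ →
      dist p q ≤ K * (3 * δ) := by
    intro p hp q hq hpq h
    obtain ⟨h1, h2⟩ := abs_le.1 h
    have h3 := hanti p hp q hq hpq
    refine (hdist p q).trans (mul_le_mul_of_nonneg_left ?_ hK)
    have h4 : |u p - u q| ≤ 2 * δ := abs_le.2 ⟨by linarith, by linarith⟩
    have h5 : |v p - v q| ≤ δ := abs_le.2 ⟨by linarith, by linarith⟩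
    linarith
  intro p hp q hq h
  rcases le_total (u q) (u p) with hpq | hpq
  · exact key p hp q hq hpq h
  · rw [dist_comm]
    exact key q hq p hp hpq (by rwa [abs_sub_comm])

/-- If each point of `E` lies in a subset of small height that projects onto a long interval, then
small pieces of the visible part are efficiently covered. -/
theorem exists_cover_visiblePart (hd : d ≠ d') (he : ‖e‖ = 1) (hed : e d' ≠ 0) {K : ℝ}
    (hK : K = 2 * |e d'|⁻¹) {R δ : ℝ} (hR : 0 < R) (hδ : 0 < δ)
    (hcyl : ∀ p ∈ E, ∃ S ⊆ E, p ∈ S ∧ (crossCoord d d' e '' S).OrdConnected ∧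
      (∃ a ∈ S, ∃ b ∈ S, 4 * R < |crossCoord d d' e a - crossCoord d d' e b|) ∧
      ∀ a ∈ S, ∀ b ∈ S, |heightCoord d' e a - heightCoord d' e b| ≤ δ) (x : Plane) :
    ∃ t : Finset Plane, ↑t ⊆ visiblePart E e ∧ (t.card : ℝ) ≤ 4 * (2 + K) * R / δ + 2 ∧
      visiblePart E e ∩ Metric.closedBall x R ⊆ ⋃ y ∈ t, Metric.closedBall y (K * (3 * δ)) := by
  classical
  set u := crossCoord d d' e
  set v := heightCoord d' e
  set V := visiblePart E e
  have hK0 : 0 ≤ K := by rw [hK]; positivity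
  have hdist := dist_le_crossCoord_add_heightCoord hd he hed
  rw [← hK] at hdist
  -- The visible points in the ball whose flat set `S` casts a shadow reaching the value `m`; only
  -- `m = u x ± 2 * R` will be used.
  let A : ℝ → Set Plane := fun m => {p ∈ V ∩ Metric.closedBall x R | ∃ S ⊆ E, p ∈ S ∧
    (u '' S).OrdConnected ∧ m ∈ u '' S ∧ ∀ a ∈ S, ∀ b ∈ S, |v a - v b| ≤ δ}
  have hAu : ∀ m, ∀ p ∈ A m, |u p - u x| ≤ 2 * R := fun m p hp =>
    (abs_crossCoord_sub_le he p x).trans (by gcongr; exact hp.1.2)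
  have hAv : ∀ m, ∀ p ∈ A m, |v p - v x| ≤ K * R := fun m p hp => by
    rw [abs_heightCoord_sub_eq]
    have h1 : |p d' - x d'| ≤ R := (Plane.abs_coord_sub_le p x d').trans hp.1.2
    have h2 : |e d'|⁻¹ ≤ K := by
      rw [hK]
      linarith [inv_nonneg.2 (abs_nonneg (e d'))]
    gcongr
  -- The shadow of the set `S` of `p` covers `u q`, so `S` has a point `q'` on the line of `q`.
  -- Visibility puts `q'` no higher than `q`, and `p` is within `δ` of `q'` in height.
  have hmono : ∀ m, ∀ p ∈ A m, ∀ q ∈ A m, u q ∈ uIcc m (u p) → v p ≤ v q + δ := by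
    rintro m p ⟨-, S, hSE, hpS, hord, hm, hS⟩ q hq hmem
    obtain ⟨q', hq'S, hq'⟩ := hord.uIcc_subset hm ⟨p, hpS, rfl⟩ hmem
    have h1 := heightCoord_le_of_mem_visiblePart hd hed hq.1.1 (hSE hq'S) hq'
    have h2 := (abs_le.1 (hS p hpS q' hq'S)).2
    linarith
  have hL : 0 ≤ 2 * (2 + K) * R := by positivity
  obtain ⟨t₁, ht₁A, ht₁c, ht₁⟩ := exists_cover_of_almost_antitone (A := A (u x - 2 * R)) (u := u)
    (v := v) (a := u x - v x - (2 + K) * R) (L := 2 * (2 + K) * R) hδ hK0 hL hdist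
    (fun p hp => by
      obtain ⟨h1, h2⟩ := abs_le.1 (hAu _ p hp)
      obtain ⟨h3, h4⟩ := abs_le.1 (hAv _ p hp)
      constructor <;> linarith)
    (fun p hp q hq h => hmono _ p hp q hq (mem_uIcc.2 (Or.inl
      ⟨by linarith [(abs_le.1 (hAu _ q hq)).1], h⟩)))
  -- Shadows reaching the right end give the reverse monotonicity, so `u` is replaced by `-u`.
  obtain ⟨t₂, ht₂A, ht₂c, ht₂⟩ := exists_cover_of_almost_antitone (A := A (u x + 2 * R))
    (u := fun p => -u p) (v := v) (a := -u x - v x - (2 + K) * R) (L := 2 * (2 + K) * R)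
    hδ hK0 hL
    (fun p q => by
      rw [neg_sub_neg, abs_sub_comm]
      exact hdist p q)
    (fun p hp => by
      obtain ⟨h1, h2⟩ := abs_le.1 (hAu _ p hp)
      obtain ⟨h3, h4⟩ := abs_le.1 (hAv _ p hp)
      constructor <;> linarith)
    (fun p hp q hq h => hmono _ p hp q hq (mem_uIcc.2 (Or.inr
      ⟨neg_le_neg_iff.1 h, by linarith [(abs_le.1 (hAu _ q hq)).2]⟩)))
  refine ⟨t₁ ∪ t₂, ?_, ?_, ?_⟩
  · rw [Finset.coe_union]
    exact union_subset (fun p hp => (ht₁A hp).1.1) fun p hp => (ht₂A hp).1.1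
  · calc ((t₁ ∪ t₂).card : ℝ) ≤ t₁.card + t₂.card := by exact_mod_cast Finset.card_union_le _ _
      _ ≤ (2 * (2 + K) * R / δ + 1) + (2 * (2 + K) * R / δ + 1) := add_le_add ht₁c ht₂c
      _ = 4 * (2 + K) * R / δ + 2 := by ring
  · rw [Finset.set_biUnion_union]
    rintro p ⟨hpV, hpx⟩
    obtain ⟨S, hSE, hpS, hord, ⟨a, ha, b, hb, hab⟩, hS⟩ := hcyl p (visiblePart_subset E e hpV)
    obtain ⟨h1, h2⟩ := abs_le.1 ((abs_crossCoord_sub_le (d := d) (d' := d') he p x).trans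
      (mul_le_mul_of_nonneg_left hpx zero_le_two))
    have hmem : ∀ {c m : ℝ}, c ∈ u '' S → m ∈ uIcc c (u p) → m ∈ u '' S := fun hc hm =>
      hord.uIcc_subset hc ⟨p, hpS, rfl⟩ hm
    -- The shadow is an interval through `u p`, which lies within `2 * R` of `u x`; being longer
    -- than `4 * R`, it cannot fit strictly between the two ends.
    have hends : u x - 2 * R ∈ u '' S ∨ u x + 2 * R ∈ u '' S := by
      by_contra! hno
      have hin : ∀ c ∈ S, u x - 2 * R < u c ∧ u c < u x + 2 * R := by
        intro c hc
        constructor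
        · by_contra! hle
          exact hno.1 (hmem ⟨c, hc, rfl⟩ (mem_uIcc.2 (Or.inl ⟨hle, by linarith⟩)))
        · by_contra! hle
          exact hno.2 (hmem ⟨c, hc, rfl⟩ (mem_uIcc.2 (Or.inr ⟨by linarith, hle⟩)))
      obtain ⟨a1, a2⟩ := hin a ha
      obtain ⟨b1, b2⟩ := hin b hb
      have : |u a - u b| ≤ 4 * R := abs_le.2 ⟨by linarith, by linarith⟩
      linarith
    rcases hends with hm | hm
    · exact Or.inl (ht₁ ⟨⟨hpV, hpx⟩, S, hSE, hpS, hord, hm, hS⟩)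
    · exact Or.inr (ht₂ ⟨⟨hpV, hpx⟩, S, hSE, hpS, hord, hm, hS⟩)

end Visible

/-! ### Flat cylinders and the Assouad dimension of visible parts -/

namespace AffineIFS

variable {κ : ℕ} {Φ : AffineIFS κ} {E : Set Plane} {d d' : Fin 2}

/-- The set is not contained in a line parallel to the axis `d'` if some cylinder has a nontrivial
projection along that axis. -/
theorem exists_coord_ne (hcarpet : Φ.IsCarpet) (hd : d ≠ d') {w : List (Fin κ)}
    (h : IsNontrivialInterval
      (projAlong (EuclideanSpace.single d' 1) '' (Φ.wordMap w '' E))) :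
    ∃ P ∈ E, ∃ Q ∈ E, P d ≠ Q d := by
  obtain ⟨a, b, hab, heq⟩ := h
  have ha : a ∈ segment ℝ a b := left_mem_segment ℝ a b
  have hb : b ∈ segment ℝ a b := right_mem_segment ℝ a b
  rw [← heq] at ha hb
  obtain ⟨_, ⟨P, hP, rfl⟩, rfl⟩ := ha
  obtain ⟨_, ⟨Q, hQ, rfl⟩, rfl⟩ := hb
  refine ⟨P, hP, Q, hQ, fun hPQ => hab ?_⟩
  rw [← sub_eq_zero, ← map_sub]
  apply projAlong_eq_zero_of_mem
  refine Submodule.mem_span_singleton.2 ⟨(Φ.wordMap w P - Φ.wordMap w Q) d', ?_⟩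
  apply Plane.ext_of_ne hd
  · have h := wordMap_sub_wordMap hcarpet w P Q d
    rw [hPQ, sub_self, mul_zero] at h
    simp [hd, h]
  · simp

/-- Small cylinders through the points of the set: their height is small, and their projections
along `e` are intervals which are long compared with the height. -/
theorem exists_cylinders (hE : Φ.IsSelfAffineSet E) (hcarpet : Φ.IsCarpet) {τ : ℝ}
    (hτ : 1 < τ) {n₀ : ℕ} (hdom : ∀ w : List (Fin κ), n₀ ≤ w.length →
      τ ^ w.length * |Φ.diagProd d' w| < |Φ.diagProd d w|) {e : Plane} (he : ‖e‖ = 1)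
    (hed : e d' ≠ 0) {n₁ : ℕ} (hint : ∀ w : List (Fin κ), n₁ ≤ w.length →
      IsNontrivialInterval (projAlong e '' (Φ.wordMap w '' E)))
    (hwide : ∃ P ∈ E, ∃ Q ∈ E, P d ≠ Q d) (M : ℝ) :
    ∃ δ₀ > 0, ∀ δ, 0 < δ → δ ≤ δ₀ → ∀ p ∈ E, ∃ S ⊆ E, p ∈ S ∧
      (crossCoord d d' e '' S).OrdConnected ∧
      (∃ a ∈ S, ∃ b ∈ S, M * δ < |crossCoord d d' e a - crossCoord d d' e b|) ∧
      ∀ a ∈ S, ∀ b ∈ S, |heightCoord d' e a - heightCoord d' e b| ≤ δ := by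
  have := hE.nonempty_index
  obtain ⟨b, B, hb, hb1, hB, hB1, hbB⟩ := exists_diag_bounds hcarpet d'
  obtain ⟨H, hH, hEH⟩ : ∃ H : ℝ, 0 < H ∧ ∀ p ∈ E, ∀ q ∈ E, |p d' - q d'| ≤ H := by
    refine ⟨Metric.diam E + 1, by linarith [Metric.diam_nonneg (s := E)], fun p hp q hq => ?_⟩
    exact (Plane.abs_coord_sub_le p q d').trans
      ((Metric.dist_le_diam_of_mem hE.2.1.isBounded hp hq).trans (by linarith))
  obtain ⟨P, hP, Q, hQ, hPQ⟩ := hwide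
  have hW : 0 < |e d'| * |P d - Q d| :=
    mul_pos (abs_pos.2 hed) (abs_pos.2 (sub_ne_zero.2 hPQ))
  set W := |e d'| * |P d - Q d| with hWdef
  have he0 : 0 < |e d'| := abs_pos.2 hed
  -- the ratio between the vertical scale of a cylinder and the prescribed height
  set c := |e d'| / H with hc
  have hc0 : 0 < c := by positivity
  -- For words this long the domination factor pays for the required width, through `M / (b * c)`,
  -- and for the loss `H` caused by the tilt of `e`.
  obtain ⟨N₂, hN₂⟩ := pow_unbounded_of_one_lt ((M / (b * c) + H) / W) hτ
  set N := max (max n₀ n₁) N₂ with hN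
  refine ⟨b ^ (N + 1) / c, by positivity, fun δ hδ hδle p hp => ?_⟩
  have hcδ : c * δ ≤ b ^ (N + 1) := by rwa [le_div_iff₀ hc0, mul_comm] at hδle
  have hcδN : c * δ < b ^ N := hcδ.trans_lt (pow_lt_pow_right_of_lt_one₀ hb hb1 (Nat.lt_succ_self N))
  -- The upper bound `c * δ` on the contraction in `d'` gives height at most `δ`; the lower bound `b
  -- * (c * δ)`, amplified by domination, gives the width.
  obtain ⟨w, hpw, hw1, hw2⟩ := hE.exists_wordMap_diagProd_le hb hB hB1 hbB (mul_pos hc0 hδ)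
    (hcδN.trans_le (pow_le_one₀ hb.le hb1.le)) hp
  have hlen : N ≤ w.length := by
    by_contra! hlt
    have h1 := pow_le_abs_diagProd hb.le (fun i => (hbB i).1) w
    have h2 : b ^ N ≤ b ^ w.length := pow_le_pow_of_le_one hb.le hb1.le hlt.le
    linarith
  have hn₀ : n₀ ≤ w.length := ((le_max_left _ _).trans (le_max_left _ _)).trans hlen
  have hn₁ : n₁ ≤ w.length := ((le_max_right _ _).trans (le_max_left _ _)).trans hlen
  have hn₂ : N₂ ≤ w.length := (le_max_right _ _).trans hlen
  refine ⟨_, hE.wordMap_image_subset w, hpw, ordConnected_crossCoord_image (hint w hn₁),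
    ⟨_, mem_image_of_mem _ hP, _, mem_image_of_mem _ hQ, ?_⟩, ?_⟩
  · have hexp : crossCoord d d' e (Φ.wordMap w P) - crossCoord d d' e (Φ.wordMap w Q) =
        e d' * (Φ.diagProd d w * (P d - Q d)) - e d * (Φ.diagProd d' w * (P d' - Q d')) := by
      rw [← wordMap_sub_wordMap hcarpet, ← wordMap_sub_wordMap hcarpet, crossCoord_apply,
        crossCoord_apply]
      ring
    rw [hexp]
    set D := |Φ.diagProd d' w|
    have hD : 0 ≤ D := abs_nonneg _
    have h1 : |e d' * (Φ.diagProd d w * (P d - Q d))| = |Φ.diagProd d w| * W := by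
      rw [abs_mul, abs_mul, hWdef]
      ring
    have h2 : |e d * (Φ.diagProd d' w * (P d' - Q d'))| ≤ D * H := by
      rw [abs_mul, abs_mul]
      refine (mul_le_of_le_one_left (by positivity) (Plane.abs_coord_le_one he d)).trans ?_
      exact mul_le_mul_of_nonneg_left (hEH P hP Q hQ) hD
    have h3 : τ ^ w.length * D * W < |Φ.diagProd d w| * W :=
      mul_lt_mul_of_pos_right (hdom w hn₀) hW
    have h4 : M / (b * c) + H < τ ^ w.length * W := by
      rw [← div_lt_iff₀ hW]
      exact hN₂.trans_le (pow_le_pow_right₀ hτ.le hn₂)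
    have h5 := abs_sub_abs_le_abs_sub (e d' * (Φ.diagProd d w * (P d - Q d)))
      (e d * (Φ.diagProd d' w * (P d' - Q d')))
    have h6 : D * (M / (b * c) + H) ≤ D * (τ ^ w.length * W) :=
      mul_le_mul_of_nonneg_left h4.le hD
    rcases le_or_gt 0 M with hM | hM
    · have h7 : b * (c * δ) * (M / (b * c)) ≤ D * (M / (b * c)) :=
        mul_le_mul_of_nonneg_right hw1 (by positivity)
      have h8 : b * (c * δ) * (M / (b * c)) = M * δ := by
        field_simp
      nlinarith
    · exact (mul_neg_of_neg_of_pos hM hδ).trans_le (abs_nonneg _)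
  · rintro _ ⟨p', hp', rfl⟩ _ ⟨q', hq', rfl⟩
    rw [abs_heightCoord_sub_eq, wordMap_sub_wordMap hcarpet, abs_mul]
    calc |e d'|⁻¹ * (|Φ.diagProd d' w| * |p' d' - q' d'|) ≤ |e d'|⁻¹ * (c * δ * H) := by
          gcongr
          exact hEH p' hp' q' hq'
      _ = δ := by
          rw [hc]
          field_simp

/-- Shrinking the radius by a factor `y` costs at most `C * y` balls, where `C` does not depend on
`y`. Since `s > 1`, a large `y` absorbs `C` into `y ^ s`; flatness of cylinders is available for
this fixed `y` at all small scales. -/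
theorem isAssouadExponent_visiblePart (hE : Φ.IsSelfAffineSet E) (hcarpet : Φ.IsCarpet)
    (hd : d ≠ d') {τ : ℝ} (hτ : 1 < τ) {n₀ : ℕ} (hdom : ∀ w : List (Fin κ), n₀ ≤ w.length →
      τ ^ w.length * |Φ.diagProd d' w| < |Φ.diagProd d w|) {e : Plane} (he : ‖e‖ = 1)
    (hed : e d' ≠ 0) {n₁ : ℕ} (hint : ∀ w : List (Fin κ), n₁ ≤ w.length →
      IsNontrivialInterval (projAlong e '' (Φ.wordMap w '' E)))
    (hwide : ∃ P ∈ E, ∃ Q ∈ E, P d ≠ Q d) {s : ℝ≥0} (hs : 1 < s) :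
    IsAssouadExponent (visiblePart E e) s := by
  set K := 2 * |e d'|⁻¹ with hK
  have hK0 : 0 < K := mul_pos two_pos (inv_pos.2 (abs_pos.2 hed))
  set C := 12 * (2 + K) * K + 2 with hC
  have hC0 : 0 < C := by positivity
  have hs1 : 0 < (s : ℝ) - 1 := sub_pos.2 (by exact_mod_cast hs)
  obtain ⟨y, hy, hy1⟩ : ∃ y : ℝ, C ≤ y ^ ((s : ℝ) - 1) ∧ 1 < y :=
    (((tendsto_rpow_atTop hs1).eventually_ge_atTop C).and (eventually_gt_atTop 1)).exists
  have hy0 : 0 < y := by linarith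
  obtain ⟨δ₀, hδ₀, hcyl⟩ := exists_cylinders hE hcarpet hτ hdom he hed hint hwide (12 * K * y)
  refine isAssouadExponent_of_local_cover (ρ := y⁻¹) (R₁ := 3 * K * y * δ₀)
    (hE.2.1.totallyBounded.subset (visiblePart_subset E e)) (inv_pos.2 hy0)
    (inv_lt_one_of_one_lt₀ hy1) (by positivity) fun x _ R hR hRR => ?_
  -- Chosen so that the covering radius `K * (3 * δ)` is exactly `y⁻¹ * R`.
  set δ := R / (3 * K * y) with hδ
  have hδ0 : 0 < δ := by positivity
  have hδle : δ ≤ δ₀ := by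
    rw [hδ, div_le_iff₀ (by positivity), mul_comm]
    exact hRR
  have e1 : 12 * K * y * δ = 4 * R := by
    rw [hδ]
    field_simp
    norm_num
  have hcyl' := hcyl δ hδ0 hδle
  rw [e1] at hcyl'
  obtain ⟨t, htV, htc, ht⟩ := exists_cover_visiblePart hd he hed hK hR hδ0 hcyl' x
  refine ⟨t, htV, htc.trans ?_, ?_⟩
  · have e2 : 4 * (2 + K) * R / δ = 12 * (2 + K) * K * y := by
      rw [hδ]
      field_simp
      norm_num
    rw [e2, one_div, inv_inv]
    calc 12 * (2 + K) * K * y + 2 ≤ C * y := by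
          rw [hC]
          linarith
      _ ≤ y ^ ((s : ℝ) - 1) * y := by gcongr
      _ = y ^ (s : ℝ) := by
          rw [← Real.rpow_add_one hy0.ne', sub_add_cancel]
  · have e3 : K * (3 * δ) = y⁻¹ * R := by
      rw [hδ]
      field_simp
    rwa [e3] at ht

end AffineIFS

/-! ### Conclusion -/

theorem assouadDim_le_one_of_forall {X : Type*} [PseudoMetricSpace X] {F : Set X}
    (h : ∀ s : ℝ≥0, 1 < s → IsAssouadExponent F s) : assouadDim F ≤ 1 := by
  refine le_of_forall_gt_imp_ge_of_dense fun a ha => ?_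
  obtain ⟨s, hs1, hsa⟩ := ENNReal.lt_iff_exists_nnreal_btwn.1 ha
  exact (iInf₂_le s (h s (by exact_mod_cast hs1))).trans hsa.le

theorem corollary4p3 {κ : ℕ} (Φ : AffineIFS κ) (E : Set Plane)
    (hE : Φ.IsSelfAffineSet E) (hcarpet : Φ.IsCarpet) (hdom : Φ.IsDominated)
    (hproj : Φ.ProjectionCondition E) :
    ∃ e₀ : Plane, ‖e₀‖ = 1 ∧ ∀ e : Plane, ‖e‖ = 1 → e ≠ e₀ → e ≠ -e₀ →
      dimH (visiblePart E e) = 1 ∧ assouadDim (visiblePart E e) = 1 := by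
  obtain ⟨d, d', hd, τ, hτ, n₀, hw⟩ := hdom.exists_dominant_coordinate hcarpet
  have hlim : ∀ e : Plane, ‖e‖ = 1 → e d' ≠ 0 → ∃ n₁ : ℕ, ∀ w : List (Fin κ), n₁ ≤ w.length →
      IsNontrivialInterval (projAlong e '' (Φ.wordMap w '' E)) := fun e he hed =>
    hproj.2 e he (AffineIFS.span_notMem_limitOrientations hcarpet hd (n₀ := n₀)
      (fun w hn => ⟨(hw w hn).1, (le_mul_of_one_le_left (abs_nonneg _)
        (one_le_pow₀ hτ.le)).trans_lt (hw w hn).2⟩) he hed)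
  obtain ⟨i⟩ := hE.nonempty_index
  have hwide : ∃ P ∈ E, ∃ Q ∈ E, P d ≠ Q d := by
    -- The `d'`-axis is itself an admissible direction, and the projection along it shows that `E`
    -- has positive extent in coordinate `d`.
    obtain ⟨n₁, hn₁⟩ := hlim (EuclideanSpace.single d' 1) (by simp) (by simp)
    exact AffineIFS.exists_coord_ne hcarpet hd (hn₁ (List.replicate n₁ i) (by simp))
  refine ⟨EuclideanSpace.single d 1, by simp, fun e he hne hne' => ?_⟩
  have hed : e d' ≠ 0 := by
    intro h0
    have h1 := Plane.norm_sq_eq hd e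
    rw [he, h0, one_pow, zero_pow two_ne_zero, add_zero, eq_comm] at h1
    rcases sq_eq_one_iff.1 h1 with h2 | h2
    · exact hne (Plane.ext_of_ne hd (by simp [h2]) (by simp [h0, hd.symm]))
    · exact hne' (Plane.ext_of_ne hd (by simp [h2]) (by simp [h0, hd.symm]))
  obtain ⟨n₁, hn₁⟩ := hlim e he hed
  have hlower : 1 ≤ dimH (visiblePart E e) := one_le_dimH_visiblePart hd hed hE.2.1
    (hE.wordMap_image_subset _) (hn₁ (List.replicate n₁ i) (by simp))
  have hmid : dimH (visiblePart E e) ≤ assouadDim (visiblePart E e) :=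
    dimH_le_assouadDim (hE.2.1.isBounded.subset (visiblePart_subset E e))
  have hupper : assouadDim (visiblePart E e) ≤ 1 := assouadDim_le_one_of_forall fun s hs =>
    AffineIFS.isAssouadExponent_visiblePart hE hcarpet hd hτ (fun w hn => (hw w hn).2) he hed hn₁
      hwide hs
  exact ⟨(hmid.trans hupper).antisymm hlower, hupper.antisymm (hlower.trans hmid)⟩
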